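/- A topological group is always assumed to be Hausdorff, and a t.d.l.c. group is a totally disconnected locally compact topological group. A topological group is compactly generated if it is generated, as an abstract group, by a compact subset. A t.d.l.c. group $G$ is regionally expansive if it has a compactly generated open subgroup $O$ and $O$ has a compact open subgroup $W$ with trivial normal core $\bigcap_{g\in O} gWg^{-1}=\{1\}$. A topological group is topologically simple if it is non-trivial and its only closed normal subgroups are the trivial subgroup and the whole group. A locally compact group $G$ is monolithic if the intersection $\mathrm{Mon}(G)$ of all non-trivial closed normal subgroups of $G$ is non-trivial; $\mathrm{Mon}(G)$ is then called the monolith of $G$ (the trivial group is not monolithic). A t.d.l.c. group $G$ is robustly monolithic if it is monolithic and its monolith, with the subspace topology, is non-discrete, regionally expansive and topologically simple. The quasi-center $\mathrm{QZ}(G)$ of a t.d.l.c. group $G$ is the set (in fact subgroup) of all elements of $G$ whose centralizer in $G$ is open. **Theorem.** Let $G$ be a robustly monolithic t.d.l.c. group and let $H$ be a non-discrete t.d.l.c. group. If there is a continuous injective homomorphism $\psi\colon H\to G$ with dense image, then $H$ is robustly monolithic. In particular, $\mathrm{QZ}(H)=\{1\}$. -/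

import Mathlib

/-- A topological group is compactly generated if it is generated, as an abstract group,
by some compact subset. -/
def IsCompactlyGeneratedGroup (G : Type*) [Group G] [TopologicalSpace G] : Prop :=
  ∃ K : Set G, IsCompact K ∧ Subgroup.closure K = ⊤

/-- Some compact open subgroup has trivial normal core (for t.d.l.c. groups, this is
expansivity of the conjugation action). -/
def IsExpansiveGroup (G : Type*) [Group G] [TopologicalSpace G] : Prop :=
  ∃ W : Subgroup G, IsOpen (W : Set G) ∧ IsCompact (W : Set G) ∧ W.normalCore = ⊥

/-- A group is regionally expansive if some compactly generated open subgroup is expansive. -/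
def IsRegionallyExpansive (G : Type*) [Group G] [TopologicalSpace G] : Prop :=
  ∃ O : Subgroup G, IsOpen (O : Set G) ∧ IsCompactlyGeneratedGroup O ∧ IsExpansiveGroup O

/-- Non-trivial, and the only closed normal subgroups are the trivial one and the whole group. -/
def IsTopologicallySimple (G : Type*) [Group G] [TopologicalSpace G] : Prop :=
  Nontrivial G ∧ ∀ N : Subgroup G, N.Normal → IsClosed (N : Set G) → N = ⊥ ∨ N = ⊤

/-- The intersection of all non-trivial closed normal subgroups. -/
def monolith (G : Type*) [Group G] [TopologicalSpace G] : Subgroup G :=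
  sInf {N : Subgroup G | N.Normal ∧ IsClosed (N : Set G) ∧ N ≠ ⊥}

/-- The intersection of all non-trivial closed normal subgroups is non-trivial. For the trivial
group this fails, as the intersection is then the whole (trivial) group. -/
def IsMonolithic (G : Type*) [Group G] [TopologicalSpace G] : Prop :=
  monolith G ≠ ⊥

/-- Monolithic, with a monolith that is (in the subspace topology) non-discrete, regionally
expansive and topologically simple. This is used for t.d.l.c. groups only. -/
structure IsRobustlyMonolithic (G : Type*) [Group G] [TopologicalSpace G] : Prop where
  monolithic : IsMonolithic G
  nondiscrete_monolith : ¬ DiscreteTopology (monolith G)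
  regionallyExpansive_monolith : IsRegionallyExpansive (monolith G)
  topologicallySimple_monolith : IsTopologicallySimple (monolith G)

/-- The quasi-center: the subgroup of all elements with open centralizer. -/
def quasiCenter (G : Type*) [Group G] [TopologicalSpace G] [IsTopologicalGroup G] :
    Subgroup G where
  carrier := {g | IsOpen (Subgroup.centralizer {g} : Set G)}
  one_mem' := by
    have h : Subgroup.centralizer {(1 : G)} = ⊤ := by
      ext x; simp [Subgroup.mem_centralizer_singleton_iff]
    simp [h]
  mul_mem' := by
    intro a b ha hb
    have hab : IsOpen ((Subgroup.centralizer {a} ⊓ Subgroup.centralizer {b} : Subgroup G) :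
        Set G) := by
      rw [Subgroup.coe_inf]; exact IsOpen.inter ha hb
    refine Subgroup.isOpen_mono ?_ hab
    rintro x ⟨hxa, hxb⟩
    have h1 : Commute x a := Subgroup.mem_centralizer_singleton_iff.1 hxa
    have h2 : Commute x b := Subgroup.mem_centralizer_singleton_iff.1 hxb
    exact Subgroup.mem_centralizer_singleton_iff.2 (h1.mul_right h2)
  inv_mem' := by
    intro a ha
    refine Subgroup.isOpen_mono ?_ ha
    intro x hx
    have h1 : Commute x a := Subgroup.mem_centralizer_singleton_iff.1 hx
    exact Subgroup.mem_centralizer_singleton_iff.2 h1.inv_right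

/-! The expansivity of `monolith G` is witnessed by finitely many elements and survives small
perturbations: `exists_finite_perturbation` gives an open subgroup `V` of `G` and a finite `F` in
the monolith such that any representatives of the cosets `fV`, `f ∈ F`, generate a group under which
`V` has trivial core. If every non-trivial normal subgroup `A` of an injectively mapped group has
image with closure containing `monolith G`, such representatives exist inside the image of `A`. This
is `IsNormallyExpansive`, which transfers the expansivity without any control on the topology of
`A`.

For non-discrete groups that property makes the quasi-center trivial, makes non-trivial normal
subgroups intersect non-trivially and, by compactness, yields a monolith. It applies to `H` by
density, and again to `monolith H`, whose image has closure containing `monolith G`. The monolith of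
`monolith H` is characteristic, hence normal in `H`, hence everything: `monolith H` is topologically
simple. -/

/-- In a t.d.l.c. group every neighbourhood of the identity contains a compact open subgroup. -/
theorem exists_compact_open_subgroup_subset {G : Type*} [Group G] [TopologicalSpace G]
    [IsTopologicalGroup G] [T2Space G] [LocallyCompactSpace G] [TotallyDisconnectedSpace G]
    {U : Set G} (hU : U ∈ nhds (1 : G)) :
    ∃ V : Subgroup G, IsOpen (V : Set G) ∧ IsCompact (V : Set G) ∧ (V : Set G) ⊆ U := by
  obtain ⟨C, hC, hCU, hCc⟩ := local_compact_nhds hU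
  obtain ⟨W, hW, h1W, hWC⟩ :=
    loc_compact_Haus_tot_disc_of_zero_dim.mem_nhds_iff.1 hC
  have hWc : IsCompact W := hCc.of_isClosed_subset hW.1 hWC
  obtain ⟨T, hT, hTW⟩ := compact_open_separated_mul_left hWc hW.2 subset_rfl
  -- The stabilizer of `W` under left translation: open because `T * W ⊆ W`, and inside `W` because
  -- `1 ∈ W`.
  let V : Subgroup G :=
    { carrier := {g | (∀ w ∈ W, g * w ∈ W) ∧ ∀ w ∈ W, g⁻¹ * w ∈ W}
      one_mem' := by simp
      mul_mem' := by
        rintro a b ⟨ha, ha'⟩ ⟨hb, hb'⟩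
        refine ⟨fun w hw => ?_, fun w hw => ?_⟩
        · rw [mul_assoc]; exact ha _ (hb _ hw)
        · rw [mul_inv_rev, mul_assoc]; exact hb' _ (ha' _ hw)
      inv_mem' := by
        rintro a ⟨ha, ha'⟩
        exact ⟨ha', by simpa using ha⟩ }
  have hVo : IsOpen (V : Set G) := by
    refine Subgroup.isOpen_of_mem_nhds V (g := 1) ?_
    filter_upwards [hT, inv_mem_nhds_one G hT] with g hg hg'
    exact ⟨fun w hw => hTW (Set.mul_mem_mul hg hw), fun w hw => hTW (Set.mul_mem_mul hg' hw)⟩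
  have hVW : (V : Set G) ⊆ W := fun g hg => by simpa using hg.1 1 h1W
  exact ⟨V, hVo, hWc.of_isClosed_subset (Subgroup.isClosed_of_isOpen V hVo) hVW,
    hVW.trans (hWC.trans hCU)⟩

/-- A finite set of cosets of a compact open subgroup `V` such that any choice of representatives
generates a subgroup meeting every coset of `V` in the group generated by `C`. -/
theorem exists_finite_coset_generators {G : Type*} [Group G] [TopologicalSpace G]
    [IsTopologicalGroup G] (V : Subgroup G) (hVo : IsOpen (V : Set G))
    (hVc : IsCompact (V : Set G)) {C D : Set G} (hC : IsCompact C) (hCinv : ∀ c ∈ C, c⁻¹ ∈ C)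
    (hCD : ∀ v ∈ V, ∀ c ∈ C, ∃ d ∈ D, d⁻¹ * (v * c) ∈ V) :
    ∃ F : Set G, F.Finite ∧ F ⊆ D ∧ ∀ r : G → G, (∀ f ∈ F, f⁻¹ * r f ∈ V) →
      ∀ g ∈ Subgroup.closure C, ∃ s ∈ Subgroup.closure (r '' F), s⁻¹ * g ∈ V := by
  obtain ⟨F, hFD, hF, hcov⟩ := (hVc.mul hC).elim_finite_subcover_image
    (b := D) (c := fun d => (fun x => d⁻¹ * x) ⁻¹' (V : Set G))
    (fun d _ => hVo.preimage (continuous_const_mul _)) (by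
      rintro _ ⟨v, hv, c, hc, rfl⟩
      obtain ⟨d, hd, h⟩ := hCD v hv c hc
      exact Set.mem_biUnion hd h)
  refine ⟨F, hF, hFD, fun r hr g hg => ?_⟩
  -- The cover gives `V * C ⊆ F * V`, so the error in `V` can be pushed to the right past each new
  -- generator.
  have key : ∀ x c, c ∈ C → (∃ s ∈ Subgroup.closure (r '' F), s⁻¹ * x ∈ V) →
      ∃ s ∈ Subgroup.closure (r '' F), s⁻¹ * (x * c) ∈ V := by
    rintro x c hc ⟨s, hs, hsx⟩
    obtain ⟨f, hf, hfm⟩ := Set.mem_iUnion₂.1 (hcov (Set.mul_mem_mul hsx hc))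
    refine ⟨s * r f, mul_mem hs (Subgroup.subset_closure ⟨f, hf, rfl⟩), ?_⟩
    have := V.mul_mem (V.inv_mem (hr f hf)) hfm
    convert this using 1
    group
  induction hg using Subgroup.closure_induction_right with
  | one => exact ⟨1, one_mem _, by simp⟩
  | mul_right x _ y hy ih => exact key x y hy ih
  | mul_inv_cancel x _ y hy ih => exact key x _ (hCinv y hy) ih

/-- A compactly generated group is generated by a symmetric compact set. -/
theorem IsCompactlyGeneratedGroup.exists_symmetric {G : Type*} [Group G] [TopologicalSpace G]
    [IsTopologicalGroup G] (h : IsCompactlyGeneratedGroup G) :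
    ∃ C : Set G, IsCompact C ∧ (∀ c ∈ C, c⁻¹ ∈ C) ∧ Subgroup.closure C = ⊤ := by
  obtain ⟨K, hK, hKt⟩ := h
  refine ⟨K ∪ K⁻¹, hK.union hK.inv, fun c hc => ?_, ?_⟩
  · rcases hc with hc | hc
    · exact Or.inr (by simpa using hc)
    · exact Or.inl hc
  · exact top_le_iff.1 (hKt ▸ Subgroup.closure_mono Set.subset_union_left)

/-- An element commuting with every element of `S` commutes with the subgroup generated by `S`. -/
theorem conj_eq_self_of_mem_closure {G : Type*} [Group G] {S : Set G} {x s : G}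
    (hx : ∀ y ∈ S, x * y = y * x) (hs : s ∈ Subgroup.closure S) : s⁻¹ * x * s = x := by
  have h : Subgroup.closure S ≤ Subgroup.centralizer {x} := by
    rw [Subgroup.closure_le]
    exact fun y hy => Subgroup.mem_centralizer_singleton_iff.2 (hx y hy).symm
  have := Subgroup.mem_centralizer_singleton_iff.1 (h hs)
  rw [mul_assoc, ← this, inv_mul_cancel_left]

/-! ### The quasi-center and discrete normal subgroups -/

section QuasiCenter

variable {G : Type*} [Group G] [TopologicalSpace G] [IsTopologicalGroup G]

theorem mem_quasiCenter_of_isOpen {x : G} (V : Subgroup G) (hV : IsOpen (V : Set G))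
    (h : ∀ v ∈ V, v * x = x * v) : x ∈ quasiCenter G :=
  Subgroup.isOpen_mono (H₁ := V)
    (fun v hv => Subgroup.mem_centralizer_singleton_iff.2 (h v hv)) hV

theorem isOpen_centralizer_of_mem_quasiCenter {x : G} (hx : x ∈ quasiCenter G) :
    IsOpen (Subgroup.centralizer {x} : Set G) := hx

instance quasiCenter_normal : (quasiCenter G).Normal where
  conj_mem x hx g := by
    refine mem_quasiCenter_of_isOpen
      ((Subgroup.centralizer {x}).comap (MulAut.conj g⁻¹).toMonoidHom) ?_ ?_
    · refine (isOpen_centralizer_of_mem_quasiCenter hx).preimage ?_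
      change Continuous fun y => g⁻¹ * y * (g⁻¹)⁻¹
      fun_prop
    · intro v hv
      have := Subgroup.mem_centralizer_singleton_iff.1 (Subgroup.mem_comap.1 hv)
      simp only [MulEquiv.coe_toMonoidHom, MulAut.conj_apply, inv_inv] at this
      have h2 := congrArg (fun z => g * z * g⁻¹) this
      simpa [mul_assoc] using h2

theorem isOpen_centralizer_of_finite {S : Set G} (hS : S.Finite) (h : S ⊆ quasiCenter G) :
    IsOpen {x : G | ∀ y ∈ S, x * y = y * x} := by
  have : {x : G | ∀ y ∈ S, x * y = y * x} = ⋂ y ∈ S, (Subgroup.centralizer {y} : Set G) := by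
    ext x
    simp only [Set.mem_ofPred_eq, Set.mem_iInter, SetLike.mem_coe,
      Subgroup.mem_centralizer_singleton_iff]
  rw [this]
  exact hS.isOpen_biInter fun y hy => h hy

/-- A normal subgroup meeting some neighbourhood of the identity trivially is quasi-central. -/
theorem le_quasiCenter_of_discrete (N : Subgroup G) [N.Normal] {U : Set G}
    (hU : IsOpen U) (h1 : (1 : G) ∈ U) (hN : ∀ x ∈ N, x ∈ U → x = 1) : N ≤ quasiCenter G := by
  intro n hn
  have hc : Continuous fun g : G => g * n * g⁻¹ * n⁻¹ := by fun_prop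
  refine Subgroup.isOpen_of_mem_nhds _ (g := 1) ?_
  filter_upwards [(hU.preimage hc).mem_nhds (by simpa using h1)] with g hg
  have h := hN _ (N.mul_mem (Subgroup.Normal.conj_mem inferInstance n hn g) (N.inv_mem hn)) hg
  rw [mul_inv_eq_one, mul_inv_eq_iff_eq_mul] at h
  exact Subgroup.mem_centralizer_singleton_iff.2 h

theorem discreteTopology_of_forall_eq_one {U : Set G} (hU : IsOpen U) (h1 : (1 : G) ∈ U)
    (h : ∀ x ∈ U, x = 1) : DiscreteTopology G := by
  refine discreteTopology_of_isOpen_singleton_one ?_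
  rwa [← (Set.eq_singleton_iff_unique_mem.2 ⟨h1, h⟩)]

end QuasiCenter

/-! ### Consequences of normal expansivity -/

/-- There is an open subgroup `V` such that every non-trivial normal subgroup contains a finite
set generating a group under whose conjugation action `V` has trivial core. -/
def IsNormallyExpansive (K : Type*) [Group K] [TopologicalSpace K] : Prop :=
  ∃ V : Subgroup K, IsOpen (V : Set K) ∧ ∀ A : Subgroup K, A.Normal → A ≠ ⊥ →
    ∃ Y : Set K, Y.Finite ∧ Y ⊆ A ∧
      ∀ x, (∀ s ∈ Subgroup.closure Y, s⁻¹ * x * s ∈ V) → x = 1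

namespace IsNormallyExpansive

variable {K : Type*} [Group K] [TopologicalSpace K] [IsTopologicalGroup K]

/-- A finite subset of the quasi-center has open centralizer. If the quasi-center were non-trivial,
that centralizer would meet `V` inside a trivial core, making the group discrete. -/
theorem quasiCenter_eq_bot (hK : IsNormallyExpansive K) (hd : ¬ DiscreteTopology K) :
    quasiCenter K = ⊥ := by
  obtain ⟨V, hVo, hV⟩ := hK
  by_contra hne
  obtain ⟨Y, hY, hYA, h⟩ := hV _ inferInstance hne
  refine hd (discreteTopology_of_forall_eq_one
    ((isOpen_centralizer_of_finite hY hYA).inter hVo) ⟨by simp, V.one_mem⟩ ?_)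
  rintro x ⟨hx, hxV⟩
  exact h x fun s hs => by rwa [conj_eq_self_of_mem_closure hx hs]

/-- An element of `V` that centralizes `A` is fixed by conjugation by `Y`, so it lies in the trivial
core. The centralizer is therefore discrete and normal, hence quasi-central. -/
theorem centralizer_eq_bot (hK : IsNormallyExpansive K) (hd : ¬ DiscreteTopology K)
    (A : Subgroup K) [A.Normal] (hA : A ≠ ⊥) : Subgroup.centralizer (A : Set K) = ⊥ := by
  have hQ := hK.quasiCenter_eq_bot hd
  obtain ⟨V, hVo, hV⟩ := hK
  obtain ⟨Y, hY, hYA, h⟩ := hV A inferInstance hA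
  rw [← le_bot_iff, ← hQ]
  refine le_quasiCenter_of_discrete _ hVo V.one_mem fun x hx hxV => h x fun s hs => ?_
  rwa [conj_eq_self_of_mem_closure (fun y hy => ?_) hs]
  exact (Subgroup.mem_centralizer_iff.1 hx y (hYA hy)).symm

theorem inf_ne_bot (hK : IsNormallyExpansive K) (hd : ¬ DiscreteTopology K)
    (A B : Subgroup K) [hAn : A.Normal] [hBn : B.Normal] (hA : A ≠ ⊥) (hB : B ≠ ⊥) :
    A ⊓ B ≠ ⊥ := by
  intro h
  refine hB (le_bot_iff.1 ?_)
  rw [← hK.centralizer_eq_bot hd A hA]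
  intro b hb
  exact Subgroup.mem_centralizer_iff.2 fun a ha =>
    Subgroup.commute_of_normal_of_disjoint A B hAn hBn (disjoint_iff.2 h) a b ha hb

theorem not_discreteTopology_of_normal (hK : IsNormallyExpansive K) (hd : ¬ DiscreteTopology K)
    (A : Subgroup K) [A.Normal] (hA : A ≠ ⊥) : ¬ DiscreteTopology A := by
  intro h
  obtain ⟨U, hU, hUA⟩ := isOpen_induced_iff.1 (isOpen_discrete ({1} : Set A))
  refine hA (le_bot_iff.1 ?_)
  rw [← hK.quasiCenter_eq_bot hd]
  refine le_quasiCenter_of_discrete A hU ?_ fun x hx hxU => ?_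
  · have : (1 : A) ∈ Subtype.val ⁻¹' U := by rw [hUA]; rfl
    simpa using this
  · have : (⟨x, hx⟩ : A) ∈ Subtype.val ⁻¹' U := hxU
    rw [hUA] at this
    exact congrArg Subtype.val (Set.mem_singleton_iff.1 this)

variable [T2Space K] [LocallyCompactSpace K] [TotallyDisconnectedSpace K]

theorem isRegionallyExpansive (hK : IsNormallyExpansive K) [Nontrivial K] :
    IsRegionallyExpansive K := by
  obtain ⟨V, hVo, hV⟩ := hK
  obtain ⟨Y, hY, -, h⟩ := hV ⊤ inferInstance top_ne_bot
  obtain ⟨U, hUo, hUc, hUV⟩ := exists_compact_open_subgroup_subset (hVo.mem_nhds V.one_mem)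
  have hsub : Y ∪ U ⊆ Subgroup.closure (Y ∪ U) := Subgroup.subset_closure
  have hUL : U ≤ Subgroup.closure (Y ∪ U) := fun u hu => hsub (Or.inr hu)
  have hLo : IsOpen (Subgroup.closure (Y ∪ U) : Set K) := Subgroup.isOpen_mono hUL hUo
  have hemb := (Subgroup.isClosed_of_isOpen _ hLo).isClosedEmbedding_subtypeVal
  refine ⟨Subgroup.closure (Y ∪ U), hLo, ⟨Subtype.val ⁻¹' (Y ∪ U),
    hemb.isCompact_preimage (hY.isCompact.union hUc), ?_⟩,
    U.subgroupOf _, hUo.preimage continuous_subtype_val, hemb.isCompact_preimage hUc, ?_⟩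
  · exact Subgroup.closure_closure_coe_preimage
  · rw [Subgroup.eq_bot_iff_forall]
    intro x hx
    refine Subtype.ext (h x fun s hs => hUV ?_)
    have hsL : s ∈ Subgroup.closure (Y ∪ U) := Subgroup.closure_mono Set.subset_union_left hs
    simpa [Subgroup.mem_subgroupOf] using hx (⟨s, hsL⟩⁻¹)

theorem isMonolithic (hK : IsNormallyExpansive K) (hd : ¬ DiscreteTopology K) :
    IsMonolithic K := by
  have hQ := hK.quasiCenter_eq_bot hd
  have hinf := fun A B hA hB => hK.inf_ne_bot hd A B (hAn := hA) (hBn := hB)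
  have hnt : Nontrivial K := by
    by_contra hn
    rw [not_nontrivial_iff_subsingleton] at hn
    exact hd inferInstance
  obtain ⟨V, hVo, hV⟩ := hK
  obtain ⟨Y, hY, -, h⟩ := hV ⊤ inferInstance top_ne_bot
  obtain ⟨U, hUo, hUc, hUV⟩ := exists_compact_open_subgroup_subset (hVo.mem_nhds V.one_mem)
  let U₁ : Set K := ⋂ y ∈ Y ∪ Y⁻¹, (fun x => y⁻¹ * x * y) ⁻¹' (U : Set K)
  have hU₁ : IsOpen U₁ :=
    (hY.union hY.inv).isOpen_biInter fun y _ => hUo.preimage (by fun_prop)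
  have h1U₁ : (1 : K) ∈ U₁ := by simp [U₁]
  let ι := {N : Subgroup K // N.Normal ∧ IsClosed (N : Set K) ∧ N ≠ ⊥}
  have : Nonempty ι := ⟨⟨⊤, inferInstance, isClosed_univ, top_ne_bot⟩⟩
  -- If `N ∩ U ⊆ U₁`, then `N ∩ U` is invariant under the group generated by `Y`, so it is trivial
  -- and `N` is quasi-central. Hence these compact sets are non-empty; a common point lies in the
  -- monolith and differs from `1`, since `1 ∈ U₁`.
  let t : ι → Set K := fun N => (N.1 ∩ U : Set K) \ U₁
  have htcl : ∀ i, IsClosed (t i) := fun i =>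
    (i.2.2.1.inter hUc.isClosed).sdiff hU₁
  have htc : ∀ i, IsCompact (t i) := fun i =>
    hUc.of_isClosed_subset (htcl i) fun x hx => hx.1.2
  have htn : ∀ i, (t i).Nonempty := by
    rintro ⟨N, hN, hNc, hNb⟩
    by_contra hemp
    have hsub : ∀ x ∈ N, x ∈ U → ∀ y ∈ Y ∪ Y⁻¹, y⁻¹ * x * y ∈ U := by
      intro x hx hxU
      have hx1 : x ∈ U₁ := by
        by_contra hx1
        exact hemp ⟨x, ⟨hx, hxU⟩, hx1⟩
      simpa only [U₁, Set.mem_iInter, Set.mem_preimage, SetLike.mem_coe] using hx1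
    have step : ∀ g, (∀ x ∈ N, x ∈ U → g⁻¹ * x * g ∈ U) → ∀ y ∈ Y ∪ Y⁻¹,
        ∀ x ∈ N, x ∈ U → (g * y)⁻¹ * x * (g * y) ∈ U := by
      intro g hg y hy x hx hxU
      have := hsub (g⁻¹ * x * g) (by simpa using hN.conj_mem x hx g⁻¹) (hg x hx hxU) y hy
      simpa [mul_assoc] using this
    refine hNb (le_bot_iff.1 ?_)
    rw [← hQ]
    refine le_quasiCenter_of_discrete N hUo U.one_mem fun x hx hxU => h x fun s hs => hUV ?_
    suffices H : ∀ x ∈ N, x ∈ U → s⁻¹ * x * s ∈ U from H x hx hxU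
    induction hs using Subgroup.closure_induction_right with
    | one => simp
    | mul_right g _ y hy ih => exact step g ih y (Or.inl hy)
    | mul_inv_cancel g _ y hy ih => exact step g ih _ (Or.inr (by simpa using hy))
  have htd : Directed (· ⊇ ·) t := by
    rintro ⟨A, hA, hAc, hAb⟩ ⟨B, hB, hBc, hBb⟩
    refine ⟨⟨A ⊓ B, inferInstance, hAc.inter hBc, hinf A B hA hB hAb hBb⟩, ?_, ?_⟩
    · exact fun x hx => ⟨⟨hx.1.1.1, hx.1.2⟩, hx.2⟩
    · exact fun x hx => ⟨⟨hx.1.1.2, hx.1.2⟩, hx.2⟩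
  obtain ⟨x, hx⟩ :=
    IsCompact.nonempty_iInter_of_directed_nonempty_isCompact_isClosed t htd htn htc htcl
  rw [Set.mem_iInter] at hx
  intro hbot
  have hxm : x ∈ monolith K :=
    Subgroup.mem_sInf.2 fun N hN => (hx ⟨N, hN⟩).1.1
  rw [hbot, Subgroup.mem_bot] at hxm
  exact (hx this.some).2 (hxm ▸ h1U₁)

end IsNormallyExpansive

/-! ### Monoliths and closures of normal subgroups -/

section Monolith

variable {G : Type*} [Group G] [TopologicalSpace G]

theorem monolith_le {N : Subgroup G} (hN : N.Normal) (hc : IsClosed (N : Set G)) (hb : N ≠ ⊥) :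
    monolith G ≤ N :=
  sInf_le ⟨hN, hc, hb⟩

instance monolith_normal : (monolith G).Normal where
  conj_mem x hx g :=
    Subgroup.mem_sInf.2 fun N hN => hN.1.conj_mem x (Subgroup.mem_sInf.1 hx N hN) g

theorem isClosed_monolith : IsClosed (monolith G : Set G) := by
  rw [monolith, Subgroup.coe_sInf]
  exact isClosed_biInter fun N hN => hN.2.1

theorem map_mem_monolith (e : G ≃* G) (he : Continuous e) {x : G} (hx : x ∈ monolith G) :
    e x ∈ monolith G := by
  refine Subgroup.mem_sInf.2 fun N hN => ?_
  refine Subgroup.mem_sInf.1 hx (N.comap e.toMonoidHom) ⟨hN.1.comap _, hN.2.1.preimage he, ?_⟩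
  intro h
  refine hN.2.2 ((Subgroup.eq_bot_iff_forall _).2 fun y hy => ?_)
  have : e.symm y ∈ N.comap e.toMonoidHom := by simpa using hy
  rw [h, Subgroup.mem_bot] at this
  simpa using this

end Monolith

theorem monolith_le_closure_map_of_denseRange {G : Type*} [Group G] [TopologicalSpace G]
    [IsTopologicalGroup G] {H : Type*} [Group H] (ψ : H →* G) (hinj : Function.Injective ψ)
    (hdense : DenseRange ψ) (A : Subgroup H) (hA : A.Normal) (hAb : A ≠ ⊥) :
    monolith G ≤ (A.map ψ).topologicalClosure := by
  have hBc := Subgroup.isClosed_topologicalClosure (A.map ψ)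
  refine monolith_le ⟨fun n hn g => ?_⟩ hBc fun h => ?_
  · have hsub : Set.range ψ ⊆ {m | m * n * m⁻¹ ∈ (A.map ψ).topologicalClosure} := by
      rintro _ ⟨b, rfl⟩
      refine map_mem_closure (f := fun y => ψ b * y * (ψ b)⁻¹)
        (IsTopologicalGroup.continuous_conj (ψ b)) hn ?_
      rintro _ ⟨a, ha, rfl⟩
      exact ⟨b * a * b⁻¹, hA.conj_mem a ha b, by simp⟩
    exact closure_minimal hsub (hBc.preimage (f := fun m => m * n * m⁻¹) (by fun_prop)) (hdense g)
  · refine hAb ((Subgroup.map_eq_bot_iff_of_injective A hinj).1 (le_bot_iff.1 ?_))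
    exact h ▸ Subgroup.le_topologicalClosure _

/-- A non-discrete, regionally expansive, topologically simple t.d.l.c. group has trivial
quasi-center. -/
theorem IsTopologicallySimple.quasiCenter_eq_bot {M : Type*} [Group M] [TopologicalSpace M]
    [IsTopologicalGroup M] (hs : IsTopologicallySimple M) (hr : IsRegionallyExpansive M)
    (hd : ¬ DiscreteTopology M) : quasiCenter M = ⊥ := by
  rcases hs.2 _ (Subgroup.is_normal_topologicalClosure (quasiCenter M))
    (Subgroup.isClosed_topologicalClosure _) with h | h
  · exact le_bot_iff.1 (h ▸ Subgroup.le_topologicalClosure _)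
  -- The quasi-center is now dense, so coset representatives generating `O` modulo `W` can be
  -- quasi-central. Their common centralizer is open and meets `W` inside its trivial core, forcing
  -- discreteness.
  exfalso
  obtain ⟨O, hO, hOc, W, hWo, hWc, hW⟩ := hr
  obtain ⟨C, hC, hCinv, hCt⟩ := hOc.exists_symmetric
  obtain ⟨F, hF, -, hFr⟩ := exists_finite_coset_generators W hWo hWc hC hCinv (D := Set.univ)
    fun v _ c _ => ⟨v * c, trivial, by simp⟩
  have hdense : ∀ f : O, ∃ q : O, f⁻¹ * q ∈ W ∧ (q : M) ∈ quasiCenter M := by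
    intro f
    have hfm : (f : M) ∈ closure (quasiCenter M : Set M) := by
      rw [← Subgroup.topologicalClosure_coe, h]; trivial
    have hopen : IsOpen (Subtype.val '' {q : O | f⁻¹ * q ∈ W}) :=
      hO.isOpenMap_subtype_val _ (hWo.preimage (continuous_const_mul f⁻¹))
    obtain ⟨_, ⟨q, hq, rfl⟩, hq'⟩ := mem_closure_iff.1 hfm _ hopen ⟨f, by simp, rfl⟩
    exact ⟨q, hq, hq'⟩
  choose r hrW hrQ using hdense
  have hfin : ((fun f => (r f : M)) '' F).Finite := hF.image _
  have hcen := isOpen_centralizer_of_finite hfin (by rintro _ ⟨f, -, rfl⟩; exact hrQ f)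
  refine hd (discreteTopology_of_forall_eq_one
    (hcen.inter (hO.isOpenMap_subtype_val _ hWo)) ⟨by simp, 1, W.one_mem, rfl⟩ ?_)
  rintro _ ⟨hx, w, hw, rfl⟩
  suffices hwc : w ∈ W.normalCore by
    rw [hW, Subgroup.mem_bot] at hwc; rw [hwc]; rfl
  intro g
  obtain ⟨s, hs, hsg⟩ := hFr r (fun f _ => hrW f) g⁻¹ (hCt ▸ Subgroup.mem_top _)
  have hcomm : s⁻¹ * w * s = w := by
    refine conj_eq_self_of_mem_closure ?_ hs
    rintro _ ⟨f, hf, rfl⟩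
    exact Subtype.ext (hx _ ⟨f, hf, rfl⟩)
  have := W.mul_mem (W.mul_mem (W.inv_mem hsg) hw) hsg
  rw [← hcomm] at this
  convert this using 1
  group

/-! ### Transferring expansivity from the monolith -/

namespace IsRobustlyMonolithic

variable {G : Type*} [Group G] [TopologicalSpace G] [IsTopologicalGroup G]

theorem quasiCenter_monolith_eq_bot (hG : IsRobustlyMonolithic G) :
    quasiCenter (monolith G) = ⊥ :=
  hG.topologicallySimple_monolith.quasiCenter_eq_bot hG.regionallyExpansive_monolith
    hG.nondiscrete_monolith

variable [T2Space G]

theorem centralizer_monolith_eq_bot (hG : IsRobustlyMonolithic G) :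
    Subgroup.centralizer (monolith G : Set G) = ⊥ := by
  by_contra hne
  have hle := monolith_le (N := Subgroup.centralizer (monolith G : Set G)) inferInstance
    (Set.isClosed_centralizer _) hne
  have htop : (⊤ : Subgroup (monolith G)) ≤ quasiCenter (monolith G) := fun x _ =>
    mem_quasiCenter_of_isOpen ⊤ isOpen_univ fun v _ =>
      Subtype.ext (Subgroup.mem_centralizer_iff.1 (hle x.2) v v.2)
  rw [hG.quasiCenter_monolith_eq_bot] at htop
  have := hG.topologicallySimple_monolith.1
  exact top_ne_bot (le_bot_iff.1 htop)

/-- In a robustly monolithic group, an open subgroup of the monolith has trivial centralizer. -/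
theorem eq_one_of_commute_open (hG : IsRobustlyMonolithic G) (O : Subgroup (monolith G))
    (hO : IsOpen (O : Set (monolith G))) {x : G} (hx : ∀ o ∈ O, x * (o : G) = o * x) : x = 1 := by
  suffices h : x ∈ Subgroup.centralizer (monolith G : Set G) by
    rwa [hG.centralizer_monolith_eq_bot, Subgroup.mem_bot] at h
  refine Subgroup.mem_centralizer_iff.2 fun m hm => ?_
  have hmem : x * m * x⁻¹ * m⁻¹ ∈ monolith G :=
    mul_mem (Subgroup.Normal.conj_mem inferInstance m hm x) (inv_mem hm)
  have hc : Continuous (MulAut.conj (⟨m, hm⟩ : monolith G)⁻¹).toMonoidHom := by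
    change Continuous fun y => (⟨m, hm⟩ : monolith G)⁻¹ * y * ((⟨m, hm⟩ : monolith G)⁻¹)⁻¹
    fun_prop
  -- The commutator `x * (m * x⁻¹ * m⁻¹)` centralizes the open subgroup `O ∩ m O m⁻¹`.
  have hq : (⟨_, hmem⟩ : monolith G) ∈ quasiCenter (monolith G) := by
    refine mem_quasiCenter_of_isOpen
      (O ⊓ O.comap (MulAut.conj (⟨m, hm⟩ : monolith G)⁻¹).toMonoidHom)
      (hO.inter (hO.preimage hc)) ?_
    rintro v ⟨hv, hv'⟩
    have h1 : Commute x (v : G) := hx v hv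
    have h2 : Commute x (m⁻¹ * v * m) := by
      have := hx _ (Subgroup.mem_comap.1 hv')
      simpa [Commute, SemiconjBy] using this
    have h3 : Commute (m * x⁻¹ * m⁻¹) (v : G) := by
      have := (Commute.conj_iff m).2 h2.inv_left
      simpa [mul_assoc] using this
    refine Subtype.ext ?_
    have h4 : Commute (x * (m * x⁻¹ * m⁻¹)) (v : G) := h1.mul_left h3
    have : x * m * x⁻¹ * m⁻¹ = x * (m * x⁻¹ * m⁻¹) := by group
    change (v : G) * (x * m * x⁻¹ * m⁻¹) = (x * m * x⁻¹ * m⁻¹) * v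
    rw [this]
    exact h4.eq.symm
  rw [hG.quasiCenter_monolith_eq_bot, Subgroup.mem_bot] at hq
  have := congrArg Subtype.val hq
  rw [OneMemClass.coe_one, mul_inv_eq_one, mul_inv_eq_iff_eq_mul] at this
  exact this.symm

/-- A robustly monolithic t.d.l.c. group has an open subgroup `V` and a finite subset `F` of the
monolith such that any perturbation of `F` modulo `V` generates a group under whose conjugation
action `V` has trivial core. -/
theorem exists_finite_perturbation [LocallyCompactSpace G] [TotallyDisconnectedSpace G]
    (hG : IsRobustlyMonolithic G) :
    ∃ (V : Subgroup G) (F : Set G), IsOpen (V : Set G) ∧ F.Finite ∧ F ⊆ monolith G ∧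
      ∀ r : G → G, (∀ f ∈ F, f⁻¹ * r f ∈ V) →
        ∀ x, (∀ s ∈ Subgroup.closure (r '' F), s⁻¹ * x * s ∈ V) → x = 1 := by
  obtain ⟨O, hO, hOc, W, hWo, hWc, hW⟩ := hG.regionallyExpansive_monolith
  obtain ⟨C₀, hC₀, hC₀inv, hC₀t⟩ := hOc.exists_symmetric
  let ι : O →* G := (monolith G).subtype.comp O.subtype
  have hι : Continuous ι := continuous_subtype_val.comp continuous_subtype_val
  obtain ⟨U, hU, hUW⟩ := isOpen_induced_iff.1 (hO.isOpenMap_subtype_val _ hWo)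
  have h1U : (1 : G) ∈ U := by
    have : (1 : monolith G) ∈ Subtype.val ⁻¹' U := hUW ▸ ⟨1, W.one_mem, rfl⟩
    exact this
  obtain ⟨V, hVo, hVc, hVU⟩ := exists_compact_open_subgroup_subset (hU.mem_nhds h1U)
  have hVW : ∀ x ∈ V, x ∈ monolith G → ∃ w ∈ W, ι w = x := by
    intro x hx hxm
    have : (⟨x, hxm⟩ : monolith G) ∈ Subtype.val ⁻¹' U := hVU hx
    rw [hUW] at this
    obtain ⟨w, hw, hwx⟩ := this
    exact ⟨w, hw, congrArg Subtype.val hwx⟩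
  -- Closing the generators under conjugation by `V` gives `V * C ⊆ C * V`, which allows `F` to be
  -- chosen in `C`, hence in the monolith.
  let C : Set G := (fun p : G × G => p.1 * p.2 * p.1⁻¹) '' ((V : Set G) ×ˢ (ι '' C₀))
  have hC : IsCompact C := (hVc.prod (hC₀.image hι)).image (by fun_prop)
  have hCinv : ∀ c ∈ C, c⁻¹ ∈ C := by
    rintro _ ⟨⟨v, _⟩, ⟨hv, c, hc, rfl⟩, rfl⟩
    exact ⟨(v, ι c⁻¹), ⟨hv, _, hC₀inv c hc, rfl⟩, by simp [mul_assoc]⟩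
  have hCm : C ⊆ monolith G := by
    rintro _ ⟨⟨v, _⟩, ⟨hv, c, hc, rfl⟩, rfl⟩
    exact Subgroup.Normal.conj_mem inferInstance _ c.1.2 v
  have hιC : ∀ o : O, ι o ∈ Subgroup.closure C := by
    have : (⊤ : Subgroup O) ≤ (Subgroup.closure C).comap ι := by
      rw [← hC₀t, Subgroup.closure_le]
      exact fun c hc => Subgroup.subset_closure ⟨(1, ι c), ⟨V.one_mem, c, hc, rfl⟩, by simp⟩
    exact fun o => this (Subgroup.mem_top o)
  obtain ⟨F, hF, hFC, hFr⟩ := exists_finite_coset_generators V hVo hVc hC hCinv (D := C) (by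
    rintro u hu _ ⟨⟨v, _⟩, ⟨hv, c, hc, rfl⟩, rfl⟩
    refine ⟨_, ⟨(u * v, ι c), ⟨V.mul_mem hu hv, c, hc, rfl⟩, rfl⟩, ?_⟩
    simpa [mul_assoc] using hu)
  refine ⟨V, F, hVo, hF, hFC.trans hCm, fun r hr x hx => ?_⟩
  have hxC : ∀ g ∈ Subgroup.closure C, g⁻¹ * x * g ∈ V := by
    intro g hg
    obtain ⟨s, hs, hsg⟩ := hFr r hr g hg
    have := V.mul_mem (V.mul_mem (V.inv_mem hsg) (hx s hs)) hsg
    convert this using 1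
    group
  have hcore : ∀ y ∈ monolith G, (∀ g ∈ Subgroup.closure C, g⁻¹ * y * g ∈ V) → y = 1 := by
    intro y hy hyV
    obtain ⟨w, hw, rfl⟩ := hVW y (by simpa using hyV 1 (one_mem _)) hy
    suffices hwc : w ∈ W.normalCore by
      rw [hW, Subgroup.mem_bot] at hwc; rw [hwc, map_one]
    intro g
    have hg := hyV _ (hιC g⁻¹)
    rw [← map_inv, ← map_mul, ← map_mul] at hg
    obtain ⟨w', hw', hww⟩ := hVW _ hg (g⁻¹⁻¹ * w * g⁻¹).1.2
    have : w' = g⁻¹⁻¹ * w * g⁻¹ := Subtype.ext (Subtype.ext hww)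
    rw [this, inv_inv] at hw'
    exact hw'
  -- The core of `V` is normalized by `O`, so it contains the commutators of `x` with `O`. These
  -- also lie in the monolith, where the core is trivial.
  refine hG.eq_one_of_commute_open O hO fun o ho => ?_
  have hoC : (o : G) ∈ Subgroup.closure C := hιC ⟨o, ho⟩
  have h := hcore (x * o * x⁻¹ * (o : G)⁻¹)
    (mul_mem (Subgroup.Normal.conj_mem inferInstance _ o.2 x) (inv_mem o.2)) (by
      intro g hg
      have h1 := hxC g hg
      have h2 := hxC ((o : G)⁻¹ * g) (mul_mem (inv_mem hoC) hg)
      have := V.mul_mem h1 (V.inv_mem h2)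
      convert this using 1
      group)
  rwa [mul_inv_eq_one, mul_inv_eq_iff_eq_mul] at h

/-- A group embedded in a robustly monolithic t.d.l.c. group such that the closure of every
non-trivial normal subgroup contains the monolith is normally expansive. -/
theorem isNormallyExpansive [LocallyCompactSpace G] [TotallyDisconnectedSpace G]
    (hG : IsRobustlyMonolithic G) {K : Type*} [Group K] [TopologicalSpace K]
    (φ : K →* G) (hcont : Continuous φ) (hinj : Function.Injective φ)
    (h : ∀ A : Subgroup K, A.Normal → A ≠ ⊥ → monolith G ≤ (A.map φ).topologicalClosure) :
    IsNormallyExpansive K := by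
  obtain ⟨V, F, hVo, hF, hFm, hr⟩ := hG.exists_finite_perturbation
  refine ⟨V.comap φ, hVo.preimage hcont, fun A hA hAb => ?_⟩
  have hex : ∀ f : G, ∃ a ∈ A, f ∈ F → f⁻¹ * φ a ∈ V := by
    intro f
    by_cases hf : f ∈ F
    · have hfm : f ∈ closure (A.map φ : Set G) := h A hA hAb (hFm hf)
      obtain ⟨_, hq, a, ha, rfl⟩ := mem_closure_iff.1 hfm _
        (hVo.preimage (continuous_const_mul f⁻¹)) (by simp)
      exact ⟨a, ha, fun _ => hq⟩
    · exact ⟨1, A.one_mem, fun h => (hf h).elim⟩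
  choose a ha haV using hex
  refine ⟨a '' F, hF.image a, by rintro _ ⟨f, -, rfl⟩; exact ha f, fun x hx => hinj ?_⟩
  rw [map_one]
  refine hr (φ ∘ a) (fun f hf => haV f hf) (φ x) fun s hs => ?_
  rw [Set.image_comp, ← MonoidHom.map_closure] at hs
  obtain ⟨s, hs, rfl⟩ := hs
  simpa using hx s hs

theorem monolith_le_closure_map_of_le_closure (hG : IsRobustlyMonolithic G) {K : Type*} [Group K]
    (φ : K →* G) (hinj : Function.Injective φ)
    (hK : monolith G ≤ φ.range.topologicalClosure) (A : Subgroup K) (hA : A.Normal)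
    (hAb : A ≠ ⊥) : monolith G ≤ (A.map φ).topologicalClosure := by
  set B := (A.map φ).topologicalClosure
  have hBc : IsClosed (B : Set G) := Subgroup.isClosed_topologicalClosure _
  have hAB : A.map φ ≤ B := Subgroup.le_topologicalClosure _
  have hconj : ∀ n ∈ B, ∀ m ∈ monolith G, m * n * m⁻¹ ∈ B := by
    intro n hn m hm
    have hsub : (φ.range : Set G) ⊆ {m | m * n * m⁻¹ ∈ B} := by
      rintro _ ⟨b, rfl⟩
      refine map_mem_closure (f := fun y => φ b * y * (φ b)⁻¹)
        (IsTopologicalGroup.continuous_conj (φ b)) hn ?_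
      rintro _ ⟨a, ha, rfl⟩
      exact ⟨b * a * b⁻¹, hA.conj_mem a ha b, by simp⟩
    exact closure_minimal hsub (hBc.preimage (f := fun m => m * n * m⁻¹) (by fun_prop)) (hK hm)
  rcases hG.topologicallySimple_monolith.2 (B.subgroupOf (monolith G))
    ⟨fun n hn g => hconj n hn g g.2⟩ (hBc.preimage continuous_subtype_val) with h | h
  -- Commutators of `A` with the monolith lie in `B ∩ monolith G`; if that is trivial, `A`
  -- centralizes the monolith and so is trivial.
  · refine (hAb ?_).elim
    refine (Subgroup.map_eq_bot_iff_of_injective A hinj).1 (le_bot_iff.1 ?_)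
    rw [← hG.centralizer_monolith_eq_bot]
    intro a ha
    refine Subgroup.mem_centralizer_iff.2 fun m hm => ?_
    have h1 : m * a * m⁻¹ * a⁻¹ ∈ B := B.mul_mem (hconj a (hAB ha) m hm) (B.inv_mem (hAB ha))
    have h2 : m * a * m⁻¹ * a⁻¹ ∈ monolith G := by
      have := mul_mem hm (Subgroup.Normal.conj_mem inferInstance _ (inv_mem hm) a)
      simpa [mul_assoc] using this
    have h3 : (⟨_, h2⟩ : monolith G) ∈ B.subgroupOf (monolith G) := h1
    rw [h, Subgroup.mem_bot] at h3
    have := congrArg Subtype.val h3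
    rwa [OneMemClass.coe_one, mul_inv_eq_one, mul_inv_eq_iff_eq_mul] at this
  · exact Subgroup.subgroupOf_eq_top.1 h

end IsRobustlyMonolithic

theorem mainTheorem1
    {G : Type*} [Group G] [TopologicalSpace G] [IsTopologicalGroup G]
    [T2Space G] [LocallyCompactSpace G] [TotallyDisconnectedSpace G]
    {H : Type*} [Group H] [TopologicalSpace H] [IsTopologicalGroup H]
    [T2Space H] [LocallyCompactSpace H] [TotallyDisconnectedSpace H]
    (hG : IsRobustlyMonolithic G) (hH : ¬ DiscreteTopology H)
    (ψ : H →* G) (hcont : Continuous ψ) (hinj : Function.Injective ψ)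
    (hdense : DenseRange ψ) :
    IsRobustlyMonolithic H ∧ quasiCenter H = ⊥ := by
  have hclos := monolith_le_closure_map_of_denseRange ψ hinj hdense
  have hHe := hG.isNormallyExpansive ψ hcont hinj hclos
  have hmon : monolith H ≠ ⊥ := hHe.isMonolithic hH
  have hmd := hHe.not_discreteTopology_of_normal hH (monolith H) hmon
  have : LocallyCompactSpace (monolith H) :=
    (isClosed_monolith (G := H)).isClosedEmbedding_subtypeVal.locallyCompactSpace
  have : Nontrivial (monolith H) := (Subgroup.nontrivial_iff_ne_bot _).2 hmon
  have hKe : IsNormallyExpansive (monolith H) :=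
    hG.isNormallyExpansive (ψ.comp (monolith H).subtype) (hcont.comp continuous_subtype_val)
      (hinj.comp Subtype.val_injective)
      (hG.monolith_le_closure_map_of_le_closure _ (hinj.comp Subtype.val_injective) (by
        rw [MonoidHom.range_comp, Subgroup.range_subtype]
        exact hclos _ inferInstance hmon))
  have hKm : monolith (monolith H) ≠ ⊥ := hKe.isMonolithic hmd
  -- Conjugation by `H` acts on `monolith H` by homeomorphic automorphisms, so it preserves the
  -- inner monolith, which is thus closed and normal in `H`.
  have hle : monolith H ≤ (monolith (monolith H)).map (monolith H).subtype := by
    refine monolith_le ⟨?_⟩ ?_ ?_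
    · rintro _ ⟨x, hx, rfl⟩ g
      refine ⟨MulAut.conjNormal g x, map_mem_monolith _ ?_ hx, MulAut.conjNormal_apply g x⟩
      refine Continuous.subtype_mk (f := fun y : monolith H => g * (y : H) * g⁻¹) ?_ _
      fun_prop
    · exact (isClosed_monolith (G := H)).isClosedEmbedding_subtypeVal.isClosedMap _
        isClosed_monolith
    · rwa [Ne, Subgroup.map_eq_bot_iff_of_injective _ (Subgroup.subtype_injective _)]
  refine ⟨⟨hmon, hmd, hKe.isRegionallyExpansive, inferInstance, fun N hN hNc => ?_⟩,
    hHe.quasiCenter_eq_bot hH⟩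
  refine or_iff_not_imp_left.2 fun hNb => top_le_iff.1 fun x _ => ?_
  obtain ⟨y, hy, hyx⟩ := hle x.2
  have : y = x := Subtype.ext hyx
  exact monolith_le hN hNc hNb (this ▸ hy)
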